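/- **Theorem (Elimination of outer subaisle double edges).** A rectangular warehouse consists of finitely many vertical aisles and at least two horizontal cross-aisles. The distance between two neighbouring aisles is positive and is the same along every cross-aisle. The part of an aisle between two consecutive cross-aisles is called a subaisle, and the strip between two consecutive cross-aisles a block; the subaisles of one block all have the same positive length. Each subaisle contains finitely many (possibly no) pick locations, all in its interior. There is one depot, which also counts as a pick location and lies either at an intersection of an aisle and a cross-aisle or at one of the pick locations inside the subaisles. Let $G$ be the graph whose vertices are the intersections and the pick locations and whose edges are the pieces of aisles and cross-aisles joining consecutive vertices, each with its length. A *tour subgraph* $T$ of $G$ is an assignment of multiplicities in $\{0,1,2,\dots\}$ to the edges of $G$ for which there is a closed walk from the depot that visits all pick locations and traverses each edge exactly as often as its multiplicity in $T$. The length of $T$ is the sum of the lengths of its edges, counted with multiplicity. A *double edge* of $T$ is a stretch of an aisle consisting of one or more consecutive full subaisles such that every edge of $G$ in the stretch has multiplicity $2$ in $T$ and no horizontal edge of $T$ is incident to an intersection strictly between the two ends of the stretch. An aisle is *non-empty* if it contains at least one pick location (the depot included). In every rectangular warehouse with at least two non-empty aisles, with any number of blocks, there is a tour subgraph $T$ of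 minimum length such that no double edge of $T$ includes a subaisle of the uppermost or of the lowermost block. -/

import Mathlib

/-- A rectangular grid of `m + 1` vertical aisles crossed by `n + 2` horizontal cross-aisles,
hence with `n + 1` blocks.  Aisles are numbered from left to right, cross-aisles and blocks
from top to bottom; block `k` lies between cross-aisles `k` and `k + 1`, and gap `g` lies between
aisles `g` and `g + 1`.  The subaisle of aisle `i` in block `k` holds `numPicks i k` pick locations
strictly between its two ends; they cut it into `numPicks i k + 1` segments, listed from top to
bottom with their lengths. -/
structure Layout (m n : ℕ) where
  /-- distance between two neighbouring aisles, the same along every cross-aisle -/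
  spacing : Fin m → ℝ
  /-- length of the subaisles of a block, the same in every aisle -/
  height : Fin (n + 1) → ℝ
  numPicks : Fin (m + 1) → Fin (n + 1) → ℕ
  segLength : ∀ i k, Fin (numPicks i k + 1) → ℝ
  spacing_pos : ∀ g, 0 < spacing g
  segLength_pos : ∀ i k j, 0 < segLength i k j
  sum_segLength : ∀ i k, ∑ j, segLength i k j = height k

namespace Layout

variable {m n : ℕ}

/-- Vertices of the warehouse graph: the intersections of aisles and cross-aisles, and the pick
locations inside the subaisles. -/
inductive Vertex (L : Layout m n) : Type
  | node (i : Fin (m + 1)) (c : Fin (n + 2)) : Vertex L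
  | pick (i : Fin (m + 1)) (k : Fin (n + 1)) (j : Fin (L.numPicks i k)) : Vertex L
  deriving DecidableEq

/-- Edges of the warehouse graph: `horiz g c` is the piece of cross-aisle `c` over gap `g`, and
`vert i k j` is the `j`-th segment of the subaisle of aisle `i` in block `k`. -/
inductive Edge (L : Layout m n) : Type
  | horiz (g : Fin m) (c : Fin (n + 2)) : Edge L
  | vert (i : Fin (m + 1)) (k : Fin (n + 1)) (j : Fin (L.numPicks i k + 1)) : Edge L
  deriving DecidableEq

/-- The vertices along a subaisle from top to bottom: the upper intersection, the pick locations,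
the lower intersection. -/
def site (L : Layout m n) (i : Fin (m + 1)) (k : Fin (n + 1)) :
    Fin (L.numPicks i k + 2) → L.Vertex :=
  Fin.cons (α := fun _ => L.Vertex) (Vertex.node i k.castSucc)
    (Fin.snoc (α := fun _ => L.Vertex) (fun j => Vertex.pick i k j) (Vertex.node i k.succ))

/-- The left or upper end of an edge. -/
def Edge.fst {L : Layout m n} : L.Edge → L.Vertex
  | .horiz g c => .node g.castSucc c
  | .vert i k j => L.site i k j.castSucc

/-- The right or lower end of an edge. -/
def Edge.snd {L : Layout m n} : L.Edge → L.Vertex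
  | .horiz g c => .node g.succ c
  | .vert i k j => L.site i k j.succ

/-- The edge `e` joins `u` and `v`. -/
def Edge.Joins {L : Layout m n} (e : L.Edge) (u v : L.Vertex) : Prop :=
  (e.fst = u ∧ e.snd = v) ∨ (e.fst = v ∧ e.snd = u)

/-- Walks in the warehouse graph; vertices and edges may be repeated. -/
inductive Route (L : Layout m n) : L.Vertex → L.Vertex → Type
  | nil (v : L.Vertex) : Route L v v
  | cons {u v w : L.Vertex} (e : L.Edge) (h : e.Joins u v) (p : Route L v w) : Route L u w

/-- The edges traversed by a walk, with repetitions. -/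
def Route.edges {L : Layout m n} {u v : L.Vertex} : L.Route u v → List L.Edge
  | .nil _ => []
  | .cons e _ p => e :: p.edges

/-- The vertices visited by a walk, with repetitions. -/
def Route.support {L : Layout m n} {u v : L.Vertex} : L.Route u v → List L.Vertex
  | .nil v => [v]
  | .cons (u := u) _ _ p => u :: p.support

/-- Total length of the multigraph that contains each edge `e` with multiplicity `T e`. -/
noncomputable def totalLength (L : Layout m n) (T : L.Edge → ℕ) : ℝ :=
  (∑ g, ∑ c, (T (.horiz g c) : ℝ) * L.spacing g) +
    ∑ i, ∑ k, ∑ j, (T (.vert i k j) : ℝ) * L.segLength i k j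

/-- `T` has a double edge in aisle `i` from cross-aisle `a` down to cross-aisle `b`: it spans one or
more subaisles, each of them is traversed twice along its whole length, and no horizontal edge of
`T` is incident to an intersection of the aisle strictly between the two ends. -/
def IsDoubleEdge (L : Layout m n) (T : L.Edge → ℕ) (i : Fin (m + 1)) (a b : Fin (n + 2)) : Prop :=
  a < b ∧
  (∀ k : Fin (n + 1), a ≤ k.castSucc → k.succ ≤ b → ∀ j, T (.vert i k j) = 2) ∧
  (∀ c, a < c → c < b → ∀ g : Fin m, g.castSucc = i ∨ g.succ = i → T (.horiz g c) = 0)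

/-- The stretch of an aisle between the cross-aisles `a < b` includes the subaisle of the first
(upper) or the last (lower) block. -/
def IncludesOuter (a b : Fin (n + 2)) : Prop := a = 0 ∨ b = Fin.last (n + 1)

end Layout

/-- A rectangular warehouse: a layout with a depot, which may be an intersection and is otherwise
one of the pick locations in the subaisles. -/
structure Warehouse (m n : ℕ) extends Layout m n where
  depot : toLayout.Vertex

namespace Warehouse

variable {m n : ℕ}

/-- The locations that have to be visited: all pick locations in the subaisles, and the depot. -/
def Required (W : Warehouse m n) (v : W.Vertex) : Prop :=
  v = W.depot ∨ ∃ i k j, v = .pick i k j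

/-- The aisle that contains a vertex. -/
def aisleOf (W : Warehouse m n) : W.Vertex → Fin (m + 1)
  | .node i _ => i
  | .pick i _ _ => i

/-- An aisle is non-empty if it contains a location that has to be visited. -/
def AisleNonempty (W : Warehouse m n) (i : Fin (m + 1)) : Prop :=
  ∃ v, W.Required v ∧ W.aisleOf v = i

/-- `T` (edges with multiplicities) is a tour subgraph: some closed walk from the depot visits all
required locations and traverses each edge `e` exactly `T e` times. -/
def IsTourSubgraph (W : Warehouse m n) (T : W.Edge → ℕ) : Prop :=
  ∃ p : W.Route W.depot W.depot,
    (∀ v, W.Required v → v ∈ p.support) ∧ ∀ e, T e = p.edges.count e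

/-- `T` is a tour subgraph of minimum length. -/
def IsMinTourSubgraph (W : Warehouse m n) (T : W.Edge → ℕ) : Prop :=
  W.IsTourSubgraph T ∧ ∀ T', W.IsTourSubgraph T' → W.totalLength T ≤ W.totalLength T'

end Warehouse

/-! By Euler's theorem (`isTourSubgraph_iff`), a multigraph is a tour subgraph exactly when all
degrees are even and the depot is connected to every required vertex and every edge used. Among the
minimum tour subgraphs, take `T` with the fewest doubled subaisles in the two outer blocks
(`IsExtremal`). The claim is that `T` has none in the upper block; reflection gives the lower block.

The main move is `shift`. Suppose aisle `i` is doubled from the top down to cross-aisle `b`, and a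
horizontal edge leads from one end of this stretch to the neighbouring aisle `i'`. Add the rectangle
between the two aisles, then delete two copies of the stretch and of that horizontal edge. Length
and parities are unchanged, and the rest of the rectangle keeps everything connected. Aisle `i` is
now single above `b`, so by extremality the doubling must reappear in the upper subaisle of `i'`
(`IsExtremal.shift`).

Let the upper subaisle of `i` be doubled. If a horizontal edge of `T` meets its top, that edge is
single (`horiz_eq_one`), so by parity there is one on each side. Shift towards a neighbour whose top
is not the depot. The edge crossed disappears, and the new doubled subaisle has at most one
horizontal edge at its top. Parity excludes exactly one, and with none the dead end can be trimmed
(`no_horiz`).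

If no horizontal edge meets the top, the top is the depot, since otherwise it could be trimmed. As
another aisle must be visited, the doubled path continues down to a cross-aisle where the tour
branches off (`exists_lower_horiz`). A shift along that branch creates a horizontal edge at the top,
which is the case already excluded. -/

namespace Layout

variable {m n : ℕ} {L : Layout m n}

/-! ### Degree parities and connectivity of multigraphs -/

/-- Edges as a disjoint union of index types. -/
def edgeEquiv (L : Layout m n) :
    L.Edge ≃ (Fin m × Fin (n + 2)) ⊕
      (Σ i : Fin (m + 1), Σ k : Fin (n + 1), Fin (L.numPicks i k + 1)) where
  toFun
    | .horiz g c => .inl (g, c)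
    | .vert i k j => .inr ⟨i, k, j⟩
  invFun
    | .inl x => .horiz x.1 x.2
    | .inr x => .vert x.1 x.2.1 x.2.2
  left_inv e := by cases e <;> rfl
  right_inv x := by rcases x with ⟨_, _⟩ | ⟨_, _, _⟩ <;> rfl

instance : Fintype L.Edge := Fintype.ofEquiv _ L.edgeEquiv.symm

theorem sum_edge {M : Type*} [AddCommMonoid M] (f : L.Edge → M) :
    ∑ e, f e = (∑ g, ∑ c, f (.horiz g c)) + ∑ i, ∑ k, ∑ j, f (.vert i k j) := by
  rw [← Equiv.sum_comp L.edgeEquiv.symm f, Fintype.sum_sum_type, Fintype.sum_prod_type,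
    Fintype.sum_sigma]
  simp only [Fintype.sum_sigma]
  rfl

/-- The number of ends of `e` at `v`, modulo two. -/
def inc (e : L.Edge) (v : L.Vertex) : ZMod 2 :=
  (if e.fst = v then 1 else 0) + if e.snd = v then 1 else 0

/-- The parity of the degree of `v` in the multigraph `T`. -/
def par (T : L.Edge → ℕ) (v : L.Vertex) : ZMod 2 := ∑ e, (T e : ZMod 2) * inc e v

/-- `u` and `v` are joined by a walk along edges of positive multiplicity. -/
def Conn (T : L.Edge → ℕ) : L.Vertex → L.Vertex → Prop :=
  Relation.ReflTransGen fun u v => ∃ e : L.Edge, 0 < T e ∧ e.Joins u v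

/-- Indicator of a single edge. -/
def single (e f : L.Edge) : ℕ := if e = f then 1 else 0

theorem Edge.Joins.symm {e : L.Edge} {u v : L.Vertex} (h : e.Joins u v) : e.Joins v u := Or.symm h

theorem Edge.joins_self (e : L.Edge) : e.Joins e.fst e.snd := Or.inl ⟨rfl, rfl⟩

theorem inc_of_joins {e : L.Edge} {u v : L.Vertex} (h : e.Joins u v) (w : L.Vertex) :
    inc e w = (if u = w then 1 else 0) + if v = w then 1 else 0 := by
  rcases h with ⟨rfl, rfl⟩ | ⟨rfl, rfl⟩
  · rfl
  · exact add_comm _ _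

theorem par_add (S T : L.Edge → ℕ) (v : L.Vertex) : par (S + T) v = par S v + par T v := by
  simp [par, add_mul, Finset.sum_add_distrib]

theorem par_single (e : L.Edge) (v : L.Vertex) : par (single e) v = inc e v := by
  simp [par, single]

theorem par_congr {S T : L.Edge → ℕ} (h : ∀ e, (S e : ZMod 2) = T e) (v : L.Vertex) :
    par S v = par T v := by
  simp [par, h]

theorem Conn.refl (T : L.Edge → ℕ) (v : L.Vertex) : Conn T v v := Relation.ReflTransGen.refl

theorem Conn.trans {T : L.Edge → ℕ} {u v w : L.Vertex} (h : Conn T u v) (h' : Conn T v w) :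
    Conn T u w := Relation.ReflTransGen.trans h h'

theorem Conn.symm {T : L.Edge → ℕ} {u v : L.Vertex} (h : Conn T u v) : Conn T v u :=
  have : Std.Symm fun u v : L.Vertex => ∃ e : L.Edge, 0 < T e ∧ e.Joins u v :=
    ⟨fun _ _ ⟨e, he, hj⟩ => ⟨e, he, hj.symm⟩⟩
  Relation.ReflTransGen.stdSymm.symm _ _ h

theorem Conn.of_joins {T : L.Edge → ℕ} {u v : L.Vertex} {e : L.Edge} (he : 0 < T e)
    (h : e.Joins u v) : Conn T u v := Relation.ReflTransGen.single ⟨e, he, h⟩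

/-- Each step of a path in `S` is replaced by a detour in `T`. Every exchange argument below
preserves connectivity in this way. -/
theorem Conn.of_edges {S T : L.Edge → ℕ} (h : ∀ e, 0 < S e → Conn T e.fst e.snd)
    {u v : L.Vertex} (huv : Conn S u v) : Conn T u v := by
  induction huv with
  | refl => exact Conn.refl _ _
  | tail _ hs ih =>
    obtain ⟨e, he, ⟨rfl, rfl⟩ | ⟨rfl, rfl⟩⟩ := hs
    · exact ih.trans (h e he)
    · exact ih.trans (h e he).symm

theorem Conn.mono {S T : L.Edge → ℕ} (h : ∀ e, 0 < S e → 0 < T e)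
    {u v : L.Vertex} (huv : Conn S u v) : Conn T u v :=
  huv.of_edges fun e he => Conn.of_joins (h e he) e.joins_self

/-! ### Walks and their edge multiplicities -/

namespace Route

/-- Multiplicities of the edges of a walk. -/
def mult {u v : L.Vertex} (p : L.Route u v) (e : L.Edge) : ℕ := p.edges.count e

theorem mult_nil (u : L.Vertex) : (nil u : L.Route u u).mult = 0 := by
  ext e; simp [mult, edges]

theorem mult_cons {u v w : L.Vertex} (e : L.Edge) (h : e.Joins u v) (p : L.Route v w) :
    (cons e h p).mult = single e + p.mult := by
  ext f; simp [mult, edges, single, List.count_cons, add_comm]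

theorem mult_pos {u v : L.Vertex} {p : L.Route u v} {e : L.Edge} : 0 < p.mult e ↔ e ∈ p.edges :=
  List.count_pos_iff

theorem par_mult {u v : L.Vertex} (p : L.Route u v) (w : L.Vertex) :
    par p.mult w = (if u = w then 1 else 0) + if v = w then 1 else 0 := by
  induction p with
  | nil u => rw [mult_nil, CharTwo.add_self_eq_zero]; simp [par]
  | @cons u v _ e h p ih =>
    rw [mult_cons, par_add, par_single, ih, inc_of_joins h]
    linear_combination CharTwo.add_self_eq_zero (R := ZMod 2) (if v = w then 1 else 0)

theorem par_closed {u : L.Vertex} (p : L.Route u u) (w : L.Vertex) : par p.mult w = 0 := by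
  rw [par_mult, CharTwo.add_self_eq_zero]

/-- Concatenation of walks. -/
def append {u v w : L.Vertex} : L.Route u v → L.Route v w → L.Route u w
  | nil _, q => q
  | cons e h p, q => cons e h (append p q)

theorem mult_append {u v w : L.Vertex} (p : L.Route u v) (q : L.Route v w) :
    (p.append q).mult = p.mult + q.mult := by
  induction p with
  | nil u => simp [append, mult_nil]
  | cons e h p ih => rw [append, mult_cons, mult_cons, ih, add_assoc]

theorem exists_reverse {u v : L.Vertex} (p : L.Route u v) : ∃ q : L.Route v u, q.mult = p.mult := by
  induction p with
  | nil u => exact ⟨nil u, rfl⟩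
  | cons e h p ih =>
    obtain ⟨q, hq⟩ := ih
    refine ⟨q.append (cons e h.symm (nil _)), ?_⟩
    rw [mult_append, mult_cons, mult_cons, mult_nil, hq, add_zero, add_comm]

theorem start_mem_support {u v : L.Vertex} (p : L.Route u v) : u ∈ p.support := by
  cases p <;> simp [support]

theorem mem_support_of_mem_edges {u v : L.Vertex} {p : L.Route u v} {e : L.Edge}
    (he : e ∈ p.edges) : e.fst ∈ p.support ∧ e.snd ∈ p.support := by
  induction p with
  | nil u => simp [edges] at he
  | cons f h p ih =>
    rcases List.mem_cons.1 he with rfl | he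
    · have := p.start_mem_support
      rcases h with ⟨h1, h2⟩ | ⟨h1, h2⟩ <;> simp [support, h1, h2, this]
    · exact ⟨List.mem_cons_of_mem _ (ih he).1, List.mem_cons_of_mem _ (ih he).2⟩

theorem conn_of_mem_support {T : L.Edge → ℕ} {u v : L.Vertex} (p : L.Route u v)
    (hp : ∀ e ∈ p.edges, 0 < T e) {w : L.Vertex} (hw : w ∈ p.support) : Conn T u w := by
  induction p with
  | nil u => simp only [support, List.mem_singleton] at hw; exact hw ▸ Conn.refl _ _
  | cons f h p ih =>
    rcases List.mem_cons.1 hw with rfl | hw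
    · exact Conn.refl _ _
    · exact (Conn.of_joins (hp f (by simp [edges])) h).trans
        (ih (fun e he => hp e (by simp [edges, he])) hw)

theorem end_mem_support {u v : L.Vertex} (p : L.Route u v) : v ∈ p.support := by
  induction p with
  | nil u => simp [support]
  | cons e h p ih => exact List.mem_cons_of_mem _ ih

theorem conn {T : L.Edge → ℕ} {u v : L.Vertex} (p : L.Route u v)
    (hp : ∀ e ∈ p.edges, 0 < T e) : Conn T u v :=
  p.conn_of_mem_support hp p.end_mem_support

theorem exists_splice {u v w : L.Vertex} (p : L.Route u v) (hw : w ∈ p.support)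
    (c : L.Route w w) : ∃ q : L.Route u v, q.mult = p.mult + c.mult := by
  induction p with
  | nil u =>
    simp only [support, List.mem_singleton] at hw
    subst hw
    exact ⟨c, by simp [mult_nil]⟩
  | cons f h p ih =>
    by_cases hwp : w ∈ p.support
    · obtain ⟨q, hq⟩ := ih hwp
      exact ⟨cons f h q, by rw [mult_cons, mult_cons, hq, add_assoc]⟩
    -- If `w` is not on the tail it is the starting vertex, and `c` is walked first.
    · rcases List.mem_cons.1 hw with rfl | hw
      · exact ⟨c.append (cons f h p), by rw [mult_append, add_comm]⟩
      · exact absurd hw hwp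

theorem exists_split {u v : L.Vertex} (p : L.Route u v) {e : L.Edge} (he : e ∈ p.edges) :
    ∃ (a b : L.Vertex) (q : L.Route u a) (r : L.Route b v), e.Joins a b ∧
      p.mult = q.mult + single e + r.mult := by
  induction p with
  | nil u => simp [edges] at he
  | cons f h p ih =>
    by_cases hep : e ∈ p.edges
    · obtain ⟨a, b, q, r, hj, hm⟩ := ih hep
      exact ⟨a, b, cons f h q, r, hj, by rw [mult_cons, mult_cons, hm]; abel⟩
    · rcases List.mem_cons.1 he with rfl | he
      · exact ⟨_, _, nil _, p, h, by rw [mult_cons, mult_nil, zero_add]⟩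
      · exact absurd he hep

/-- An edge that a closed walk uses once has its ends joined by the rest of the walk. -/
theorem conn_of_closed {T : L.Edge → ℕ} {u : L.Vertex} (p : L.Route u u) {e : L.Edge}
    (he : p.mult e = 1) (hT : ∀ f, 0 < p.mult f → f ≠ e → 0 < T f) : Conn T e.fst e.snd := by
  obtain ⟨a, b, q, r, hj, hm⟩ := p.exists_split (mult_pos.1 (by omega : 0 < p.mult e))
  have h0 : q.mult e = 0 ∧ r.mult e = 0 := by
    have := congrFun hm e
    simp [single, he] at this
    omega
  have hf (f) : p.mult f = q.mult f + single e f + r.mult f := congrFun hm f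
  have hq : Conn T u a := q.conn fun f hf' => by
    have := mult_pos.2 hf'
    exact hT f (by rw [hf]; omega) (by rintro rfl; omega)
  have hr : Conn T b u := r.conn fun f hf' => by
    have := mult_pos.2 hf'
    exact hT f (by rw [hf]; omega) (by rintro rfl; omega)
  have hab := (hr.trans hq).symm
  rcases hj with ⟨rfl, rfl⟩ | ⟨rfl, rfl⟩
  · exact hab
  · exact hab.symm

end Route

/-! ### Euler's theorem -/

theorem exists_joins_of_inc_ne {e : L.Edge} {u : L.Vertex} (h : inc e u ≠ 0) :
    ∃ v, e.Joins u v := by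
  by_cases h1 : e.fst = u
  · exact ⟨e.snd, Or.inl ⟨h1, rfl⟩⟩
  · by_cases h2 : e.snd = u
    · exact ⟨e.fst, Or.inr ⟨rfl, h2⟩⟩
    · simp [inc, h1, h2] at h

theorem exists_single_add {R : L.Edge → ℕ} {e : L.Edge} (he : 0 < R e) :
    ∃ R', R = single e + R' := by
  refine ⟨fun f => R f - single e f, funext fun f => ?_⟩
  simp only [Pi.add_apply, single]
  split_ifs with h
  · subst h; omega
  · omega

/-- Greedy walking: as long as the current vertex differs from `v` its remaining degree is odd, so
an unused edge leaves it. Using that edge moves the odd vertex to its other end. -/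
theorem exists_route_of_par (N : ℕ) : ∀ (R : L.Edge → ℕ) (u v : L.Vertex), ∑ e, R e = N →
    (∀ w, par R w = (if u = w then 1 else 0) + if v = w then 1 else 0) →
    ∃ p : L.Route u v, p.mult ≤ R := by
  induction N with
  | zero =>
    intro R u v hN hpar
    have h0 : ∀ e, R e = 0 := by simpa using hN
    have := hpar u
    by_cases huv : u = v
    · subst huv
      exact ⟨.nil u, by rw [Route.mult_nil]; exact fun _ => Nat.zero_le _⟩
    · simp [par, h0, Ne.symm huv] at this
  | succ N ih =>
    intro R u v hN hpar
    by_cases huv : u = v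
    · subst huv
      exact ⟨.nil u, by rw [Route.mult_nil]; exact fun _ => Nat.zero_le _⟩
    · have hne : par R u ≠ 0 := by rw [hpar u]; simp [Ne.symm huv]
      obtain ⟨e, -, he⟩ := Finset.exists_ne_zero_of_sum_ne_zero hne
      have hR : 0 < R e := Nat.pos_of_ne_zero fun h => he (by simp [h])
      obtain ⟨u', hj⟩ := exists_joins_of_inc_ne (right_ne_zero_of_mul he)
      obtain ⟨R', rfl⟩ := exists_single_add hR
      obtain ⟨p, hp⟩ := ih R' u' v
        (by simp [Finset.sum_add_distrib, single] at hN; omega)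
        (fun w => by
          have := hpar w
          rw [par_add, par_single, inc_of_joins hj] at this
          linear_combination this - CharTwo.add_self_eq_zero (R := ZMod 2) (if u' = w then 1 else 0))
      exact ⟨.cons e hj p, by rw [Route.mult_cons]; exact add_le_add_right hp _⟩

/-- Hierholzer's algorithm: a closed walk that has not used up `T` meets an unused edge, by
connectivity. That edge extends to a closed walk in the remainder `R`, which is spliced in. -/
theorem exists_tour_of_conn {T : L.Edge → ℕ} {d : L.Vertex} (hpar : ∀ v, par T v = 0)
    (hconn : ∀ e, 0 < T e → Conn T d e.fst) : ∃ p : L.Route d d, p.mult = T := by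
  suffices h : ∀ (N : ℕ) (p : L.Route d d) (R : L.Edge → ℕ), T = p.mult + R → ∑ e, R e = N →
      ∃ q : L.Route d d, q.mult = T from
    h _ (.nil d) T (by simp [Route.mult_nil]) rfl
  intro N
  induction N using Nat.strong_induction_on with
  | _ N ih =>
  intro p R hT hN
  by_cases h0 : ∀ e (v w : L.Vertex), e.Joins v w → v ∈ p.support → R e = 0
  · have hreach : ∀ v, Conn T d v → v ∈ p.support := by
      intro v hv
      induction hv with
      | refl => exact p.start_mem_support
      | @tail a b _ hs ihs =>
        obtain ⟨e, he, hj⟩ := hs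
        have hm : 0 < p.mult e := by
          have := h0 e a b hj ihs
          rw [hT, Pi.add_apply, this] at he
          exact he
        have := Route.mem_support_of_mem_edges (Route.mult_pos.1 hm)
        rcases hj with ⟨-, rfl⟩ | ⟨rfl, -⟩
        · exact this.2
        · exact this.1
    refine ⟨p, ?_⟩
    rw [hT]
    funext e
    by_cases hR : R e = 0
    · simp [hR]
    · exact absurd (h0 e e.fst e.snd e.joins_self
        (hreach _ (hconn e (by rw [hT, Pi.add_apply]; omega)))) hR
  · push Not at h0
    obtain ⟨e, v, w, hj, hv, hR⟩ := h0
    obtain ⟨R', rfl⟩ := exists_single_add (Nat.pos_of_ne_zero hR)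
    -- All degrees of `R` are even, so without the edge `e` exactly its two ends are odd, and a
    -- return walk exists.
    obtain ⟨c, hc⟩ := exists_route_of_par _ R' w v rfl (fun x => by
      have h := hpar x
      rw [hT, par_add, p.par_closed, par_add, par_single, inc_of_joins hj] at h
      generalize (if v = x then (1 : ZMod 2) else 0) = a at h ⊢
      generalize (if w = x then (1 : ZMod 2) else 0) = b at h ⊢
      generalize par R' x = r at h ⊢
      revert a b r
      decide)
    obtain ⟨q, hq⟩ := p.exists_splice hv (.cons e hj c)
    obtain ⟨R'', hR''⟩ : ∃ R'', R' = c.mult + R'' :=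
      ⟨fun f => R' f - c.mult f, funext fun f => by
        have : c.mult f ≤ R' f := hc f
        simp only [Pi.add_apply]
        omega⟩
    refine ih (∑ f, R'' f) ?_ q R'' ?_ rfl
    · rw [← hN, hR'']
      simp [Finset.sum_add_distrib, single]
      omega
    · rw [hT, hq, hR'', Route.mult_cons]; abel

end Layout

namespace Warehouse

open Layout

variable {m n : ℕ} {W : Warehouse m n}

theorem isTourSubgraph_iff {T : W.Edge → ℕ} : W.IsTourSubgraph T ↔
    (∀ v, par T v = 0) ∧ (∀ v, W.Required v → Conn T W.depot v) ∧
      ∀ e, 0 < T e → Conn T W.depot e.fst := by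
  constructor
  · rintro ⟨p, hreq, hT⟩
    have hT : T = p.mult := funext hT
    subst hT
    exact ⟨p.par_closed, fun v hv => p.conn_of_mem_support (fun e => Route.mult_pos.2) (hreq v hv),
      fun e he => p.conn_of_mem_support (fun e => Route.mult_pos.2)
        (Route.mem_support_of_mem_edges (Route.mult_pos.1 he)).1⟩
  · rintro ⟨hpar, hreq, hconn⟩
    obtain ⟨p, rfl⟩ := exists_tour_of_conn hpar hconn
    refine ⟨p, fun v hv => ?_, fun _ => rfl⟩
    have key : ∀ v, Conn p.mult W.depot v → v ∈ p.support := by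
      intro v hv
      induction hv with
      | refl => exact p.start_mem_support
      | tail _ hs _ =>
        obtain ⟨e, he, hj⟩ := hs
        have := Route.mem_support_of_mem_edges (Route.mult_pos.1 he)
        rcases hj with ⟨-, rfl⟩ | ⟨rfl, -⟩
        · exact this.2
        · exact this.1
    exact key v (hreq v hv)

end Warehouse

/-! ### Lengths, subaisles, columns and rectangles -/

namespace Layout

variable {m n : ℕ} {L : Layout m n}

/-- Length of an edge. -/
def elen : L.Edge → ℝ
  | .horiz g _ => L.spacing g
  | .vert i k j => L.segLength i k j

theorem elen_pos (e : L.Edge) : 0 < elen e := by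
  cases e with
  | horiz g c => exact L.spacing_pos g
  | vert i k j => exact L.segLength_pos i k j

theorem totalLength_eq (T : L.Edge → ℕ) : L.totalLength T = ∑ e, (T e : ℝ) * elen e := by
  rw [sum_edge]; rfl

theorem totalLength_add (S T : L.Edge → ℕ) :
    L.totalLength (S + T) = L.totalLength S + L.totalLength T := by
  simp [totalLength_eq, add_mul, Finset.sum_add_distrib]

theorem totalLength_single (e : L.Edge) : L.totalLength (single e) = elen e := by
  simp [totalLength_eq, single]

theorem totalLength_mono {S T : L.Edge → ℕ} (h : S ≤ T) : L.totalLength S ≤ L.totalLength T := by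
  rw [totalLength_eq, totalLength_eq]
  exact Finset.sum_le_sum fun e _ =>
    mul_le_mul_of_nonneg_right (by exact_mod_cast h e) (elen_pos e).le

theorem totalLength_lt {S T : L.Edge → ℕ} (h : S ≤ T) {e : L.Edge} (he : S e < T e) :
    L.totalLength S < L.totalLength T := by
  rw [totalLength_eq, totalLength_eq]
  exact Finset.sum_lt_sum (fun e _ =>
    mul_le_mul_of_nonneg_right (by exact_mod_cast h e) (elen_pos e).le)
    ⟨e, Finset.mem_univ _, mul_lt_mul_of_pos_right (by exact_mod_cast he) (elen_pos e)⟩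

@[simp] theorem site_zero (i : Fin (m + 1)) (k : Fin (n + 1)) :
    L.site i k 0 = .node i k.castSucc := rfl

@[simp] theorem site_last (i : Fin (m + 1)) (k : Fin (n + 1)) :
    L.site i k (Fin.last _) = .node i k.succ := by
  rw [← Fin.succ_last]
  simp [site]

theorem site_pick (i : Fin (m + 1)) (k : Fin (n + 1)) (j : Fin (L.numPicks i k)) :
    L.site i k j.castSucc.succ = .pick i k j := by
  simp [site]

theorem site_cases {i : Fin (m + 1)} {k : Fin (n + 1)}
    {motive : Fin (L.numPicks i k + 2) → Prop} (zero : motive 0) (last : motive (Fin.last _))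
    (pick : ∀ j : Fin (L.numPicks i k), motive j.castSucc.succ) (j) : motive j := by
  refine Fin.cases zero (fun j => ?_) j
  refine Fin.lastCases ?_ (fun j => pick j) j
  rwa [Fin.succ_last]

theorem site_eq_node {i i' : Fin (m + 1)} {k : Fin (n + 1)} {c : Fin (n + 2)}
    {j : Fin (L.numPicks i k + 2)} : L.site i k j = .node i' c ↔
      i = i' ∧ (j.val = 0 ∧ c.val = k.val ∨ j.val = L.numPicks i k + 1 ∧ c.val = k.val + 1) := by
  induction j using site_cases with
  | zero => simp [Fin.ext_iff, eq_comm]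
  | last => simp [Fin.ext_iff, eq_comm]
  | pick j => simp [site_pick, j.isLt.ne]

theorem site_eq_pick {i i' : Fin (m + 1)} {k k' : Fin (n + 1)} {j' : Fin (L.numPicks i' k')}
    {j : Fin (L.numPicks i k + 2)} : L.site i k j = .pick i' k' j' ↔
      i = i' ∧ k = k' ∧ j.val = j'.val + 1 := by
  induction j using site_cases with
  | zero => simp
  | last =>
    simp only [site_last, reduceCtorEq, Fin.val_last, false_iff]
    rintro ⟨rfl, rfl, h⟩
    have := j'.isLt
    omega
  | pick j =>
    rw [site_pick, Vertex.pick.injEq]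
    constructor
    · rintro ⟨rfl, rfl, h⟩
      rw [heq_iff_eq] at h
      simp [h]
    · rintro ⟨rfl, rfl, h⟩
      simpa [Fin.ext_iff] using h

/-- Indicator of the first `j` segments of a subaisle. -/
def segs (i : Fin (m + 1)) (k : Fin (n + 1)) (j : ℕ) : L.Edge → ℕ
  | .horiz _ _ => 0
  | .vert i' k' j' => if i' = i ∧ k' = k ∧ j'.val < j then 1 else 0

/-- Indicator of the part of aisle `i` above cross-aisle `b`. -/
def col (i : Fin (m + 1)) (b : Fin (n + 2)) : L.Edge → ℕ
  | .horiz _ _ => 0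
  | .vert i' k _ => if i' = i ∧ k.val < b.val then 1 else 0

theorem col_le_one (i : Fin (m + 1)) (b : Fin (n + 2)) (e : L.Edge) : col i b e ≤ 1 := by
  cases e <;> simp only [col] <;> (try split_ifs) <;> omega

theorem exists_route_segs (i : Fin (m + 1)) (k : Fin (n + 1)) (j : Fin (L.numPicks i k + 2)) :
    ∃ p : L.Route (.node i k.castSucc) (L.site i k j), p.mult = segs i k j.val := by
  induction j using Fin.induction with
  | zero =>
    rw [site_zero]
    refine ⟨.nil _, ?_⟩
    rw [Route.mult_nil]
    funext e
    cases e <;> simp [segs]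
  | succ j ih =>
    obtain ⟨p, hp⟩ := ih
    have hj : (Edge.vert i k j).Joins (L.site i k j.castSucc) (L.site i k j.succ) :=
      Edge.joins_self _
    refine ⟨p.append (.cons (.vert i k j) hj (.nil _)), ?_⟩
    rw [Route.mult_append, Route.mult_cons, Route.mult_nil, hp]
    funext e
    cases e with
    | horiz g c => simp [segs, single]
    | vert i' k' j' =>
      by_cases h : i' = i ∧ k' = k
      · obtain ⟨rfl, rfl⟩ := h
        simp only [segs, single, Pi.add_apply, Edge.vert.injEq, heq_iff_eq, Fin.ext_iff,
          Fin.val_castSucc, Fin.val_succ, Pi.zero_apply, true_and]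
        split_ifs <;> omega
      · have h1 : ¬ (i' = i ∧ k' = k ∧ j'.val < j.succ.val) := fun h' => h ⟨h'.1, h'.2.1⟩
        have h2 : ¬ (i' = i ∧ k' = k ∧ j'.val < j.castSucc.val) := fun h' => h ⟨h'.1, h'.2.1⟩
        have h3 : ¬ (Edge.vert i k j : L.Edge) = .vert i' k' j' := by
          intro h'
          injection h' with h1 h2
          exact h ⟨h1.symm, h2.symm⟩
        simp only [segs, single, Pi.add_apply, if_neg h1, if_neg h2, if_neg h3, add_zero]

theorem exists_route_col (i : Fin (m + 1)) (b : Fin (n + 2)) :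
    ∃ p : L.Route (.node i 0) (.node i b), p.mult = col i b := by
  induction b using Fin.induction with
  | zero =>
    refine ⟨.nil _, ?_⟩
    rw [Route.mult_nil]
    funext e
    cases e <;> simp [col]
  | succ k ih =>
    obtain ⟨p, hp⟩ := ih
    have hq := L.exists_route_segs i k (Fin.last _)
    rw [site_last] at hq
    obtain ⟨q, hq⟩ := hq
    refine ⟨p.append q, ?_⟩
    rw [Route.mult_append, hp, hq]
    funext e
    cases e with
    | horiz g c => simp [segs, col]
    | vert i' k' j' =>
      simp only [segs, col, Pi.add_apply, Fin.val_castSucc, Fin.val_succ, Fin.val_last,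
        Fin.ext_iff]
      have : j'.val < L.numPicks i' k' + 1 := j'.isLt
      by_cases hi : i'.val = i.val <;> by_cases hk : k'.val = k.val
      · obtain rfl := Fin.ext hi
        obtain rfl := Fin.ext hk
        simp [this]
      all_goals simp only [hi, hk, true_and, false_and, and_false, if_false]
      all_goals split_ifs <;> omega

/-- Gap `g` separates the aisles `i` and `i'`. -/
def Separates (g : Fin m) (i i' : Fin (m + 1)) : Prop :=
  (g.castSucc = i ∧ g.succ = i') ∨ (g.castSucc = i' ∧ g.succ = i)

theorem Separates.symm {g : Fin m} {i i' : Fin (m + 1)} (h : Separates g i i') :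
    Separates g i' i := Or.symm h

theorem Separates.ne {g : Fin m} {i i' : Fin (m + 1)} (h : Separates g i i') : i ≠ i' := by
  simp only [Separates, Fin.ext_iff, Fin.val_castSucc, Fin.val_succ] at h
  rintro rfl
  omega

theorem Separates.joins {g : Fin m} {i i' : Fin (m + 1)} (h : Separates g i i')
    (c : Fin (n + 2)) : (Edge.horiz g c : L.Edge).Joins (.node i c) (.node i' c) := by
  rcases h with ⟨rfl, rfl⟩ | ⟨rfl, rfl⟩
  · exact Or.inl ⟨rfl, rfl⟩
  · exact Or.inr ⟨rfl, rfl⟩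

theorem exists_separates {g : Fin m} {i : Fin (m + 1)} (hg : g.castSucc = i ∨ g.succ = i) : ∃ i', Separates g i i' := by
  rcases hg with h | h
  · exact ⟨g.succ, Or.inl ⟨h, rfl⟩⟩
  · exact ⟨g.castSucc, Or.inr ⟨rfl, h⟩⟩

theorem Separates.right {g : Fin m} {i i' : Fin (m + 1)} (h : Separates g i i') :
    g.castSucc = i' ∨ g.succ = i' := by
  rcases h with ⟨_, h⟩ | ⟨h, _⟩ <;> simp [h]

/-- Indicator of a rectangle between the upper cross-aisle and cross-aisle `b`. -/
def rect (g : Fin m) (i i' : Fin (m + 1)) (b : Fin (n + 2)) : L.Edge → ℕ :=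
  col i b + col i' b + single (.horiz g 0) + single (.horiz g b)

theorem exists_route_rect {g : Fin m} {i i' : Fin (m + 1)} (h : Separates g i i')
    (b : Fin (n + 2)) : ∃ p : L.Route (.node i 0) (.node i 0), p.mult = rect g i i' b := by
  obtain ⟨p, hp⟩ := L.exists_route_col i b
  obtain ⟨q, hq⟩ := L.exists_route_col i' b
  obtain ⟨r, hr⟩ := q.exists_reverse
  refine ⟨p.append (.cons _ (h.joins b) (r.append (.cons _ (h.symm.joins 0) (.nil _)))), ?_⟩
  simp only [Route.mult_append, Route.mult_cons, Route.mult_nil, hp, hr, hq, rect]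
  abel

/-- Both lengths are the sum of the block heights above `b`. This makes the shift between aisles
length-preserving. -/
theorem totalLength_col (i i' : Fin (m + 1)) (b : Fin (n + 2)) :
    L.totalLength (col i b) = L.totalLength (col i' b) := by
  have key (i : Fin (m + 1)) : L.totalLength (col i b) =
      ∑ k : Fin (n + 1), if k.val < b.val then L.height k else 0 := by
    rw [totalLength]
    rw [Finset.sum_eq_single i]
    · simp only [col, Nat.cast_zero, zero_mul, Finset.sum_const_zero, zero_add, true_and]
      refine Finset.sum_congr rfl fun k _ => ?_
      split_ifs
      · simp [L.sum_segLength]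
      · simp
    · intro a _ ha
      simp [col, ha]
    · simp
  rw [key, key]

/-! ### Parity at a single vertex -/

theorem even_add_of_par {T : L.Edge → ℕ} {v : L.Vertex} (hpar : par T v = 0) {e f : L.Edge}
    (hef : e ≠ f) (he : inc e v = 1) (hf : inc f v = 1)
    (h : ∀ a, a ≠ e → a ≠ f → 0 < T a → inc a v = 0) : Even (T e + T f) := by
  have h2 : par T v = T e + T f := by
    rw [par, Finset.sum_eq_add e f hef]
    · simp [he, hf]
    · rintro a - ⟨hae, haf⟩
      rcases Nat.eq_zero_or_pos (T a) with h0 | h0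
      · simp [h0]
      · simp [h a hae haf h0]
    · simp
    · simp
  rw [h2] at hpar
  exact (ZMod.natCast_eq_zero_iff_even).1 (by exact_mod_cast hpar)

theorem inc_horiz_pick (g : Fin m) (c : Fin (n + 2)) {i : Fin (m + 1)} {k : Fin (n + 1)}
    (j : Fin (L.numPicks i k)) : inc (.horiz g c) (.pick i k j : L.Vertex) = 0 := by
  simp [inc, Edge.fst, Edge.snd]

theorem inc_vert_pick {i i' : Fin (m + 1)} {k k' : Fin (n + 1)}
    (j : Fin (L.numPicks i k)) (j' : Fin (L.numPicks i' k' + 1)) :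
    inc (.vert i' k' j') (.pick i k j : L.Vertex) =
      if i' = i ∧ k' = k ∧ (j'.val = j.val ∨ j'.val = j.val + 1) then 1 else 0 := by
  simp only [inc, Edge.fst, Edge.snd, site_eq_pick, Fin.val_castSucc, Fin.val_succ]
  by_cases h : i' = i ∧ k' = k
  · obtain ⟨rfl, rfl⟩ := h
    simp only [true_and]
    split_ifs <;> first | omega | rfl
  · have h' (p : Prop) : ¬ (i' = i ∧ k' = k ∧ p) := fun h' => h ⟨h'.1, h'.2.1⟩
    simp [h']

theorem inc_horiz_node {g : Fin m} {c c' : Fin (n + 2)} {i : Fin (m + 1)} :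
    inc (.horiz g c) (.node i c' : L.Vertex) =
      if c = c' ∧ (g.castSucc = i ∨ g.succ = i) then 1 else 0 := by
  simp only [inc, Edge.fst, Edge.snd, Vertex.node.injEq, Fin.ext_iff, Fin.val_castSucc,
    Fin.val_succ]
  split_ifs <;> first | omega | rfl

theorem inc_vert_node {i i' : Fin (m + 1)} {c : Fin (n + 2)} {k : Fin (n + 1)}
    {j : Fin (L.numPicks i k + 1)} : inc (.vert i k j) (.node i' c : L.Vertex) =
      if i = i' ∧ (j.val = 0 ∧ c.val = k.val ∨ j.val = L.numPicks i k ∧ c.val = k.val + 1)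
        then 1 else 0 := by
  simp only [inc, Edge.fst, Edge.snd, site_eq_node, Fin.val_castSucc, Fin.val_succ]
  by_cases h : i = i'
  · subst h
    have := j.isLt
    simp only [true_and, false_and, false_or, Nat.add_eq_zero_iff, one_ne_zero, and_false]
    split_ifs <;> first | omega | rfl
  · simp [h]

theorem vert_congr {i : Fin (m + 1)} {k : Fin (n + 1)} {i' k'} (hi : i' = i) (hk : k' = k)
    {j : Fin (L.numPicks i k + 1)} {j' : Fin (L.numPicks i' k' + 1)} (hj : j'.val = j.val) :
    (Edge.vert i' k' j' : L.Edge) = .vert i k j := by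
  subst hi hk
  rw [Fin.ext hj]

/-- The multiplicities of the two segments at a pick location have the same parity. -/
theorem even_add_pick {T : L.Edge → ℕ} {i : Fin (m + 1)} {k : Fin (n + 1)}
    (j : Fin (L.numPicks i k)) (hpar : par T (.pick i k j) = 0) :
    Even (T (.vert i k j.castSucc) + T (.vert i k j.succ)) := by
  refine even_add_of_par hpar ?_ ?_ ?_ ?_
  · simp [Fin.ext_iff]
  · rw [inc_vert_pick, if_pos ⟨rfl, rfl, Or.inl rfl⟩]
  · rw [inc_vert_pick, if_pos ⟨rfl, rfl, Or.inr rfl⟩]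
  · rintro (⟨g, c⟩ | ⟨i', k', j'⟩) h1 h2 -
    · exact inc_horiz_pick g c j
    · rw [inc_vert_pick, if_neg]
      rintro ⟨hi, hk, h | h⟩
      · exact h1 (vert_congr hi hk h)
      · exact h2 (vert_congr hi hk h)

/-- The multiplicities above and below an intersection without horizontal edges have the same
parity. -/
theorem even_add_node {T : L.Edge → ℕ} {i : Fin (m + 1)} {k k' : Fin (n + 1)}
    (hk : k.val = k'.val + 1) (hpar : par T (.node i k.castSucc) = 0)
    (hT : ∀ g : Fin m, g.castSucc = i ∨ g.succ = i → T (.horiz g k.castSucc) = 0) :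
    Even (T (.vert i k' (Fin.last _)) + T (.vert i k 0)) := by
  refine even_add_of_par hpar ?_ ?_ ?_ ?_
  · intro h
    injection h with _ h
    rw [h] at hk
    omega
  · rw [inc_vert_node, if_pos ⟨rfl, Or.inr ⟨rfl, hk⟩⟩]
  · rw [inc_vert_node, if_pos ⟨rfl, Or.inl ⟨rfl, rfl⟩⟩]
  · rintro (⟨g, c⟩ | ⟨i', k'', j'⟩) h1 h2 h3
    · rw [inc_horiz_node, if_neg]
      rintro ⟨rfl, h⟩
      rw [hT g h] at h3
      omega
    · rw [inc_vert_node, if_neg]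
      rintro ⟨rfl, ⟨h, h'⟩ | ⟨h, h'⟩⟩
      · exact h2 (vert_congr rfl (Fin.ext h'.symm) h)
      · obtain rfl : k'' = k' := Fin.ext (by rw [Fin.val_castSucc] at h'; omega)
        exact h1 (vert_congr rfl rfl h)

/-- An end of a doubled segment at the upper cross-aisle cannot have exactly one horizontal edge. -/
theorem exists_other_horiz {T : L.Edge → ℕ} {i : Fin (m + 1)} {g : Fin m}
    (hpar : par T (.node i 0) = 0) (hg : g.castSucc = i ∨ g.succ = i)
    (h1 : T (.horiz g 0) = 1) (h2 : T (.vert i 0 0) = 2) :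
    ∃ g', g' ≠ g ∧ (g'.castSucc = i ∨ g'.succ = i) ∧ 0 < T (.horiz g' 0) := by
  by_contra! hcon
  have := even_add_of_par hpar (e := .vert i 0 0) (f := .horiz g 0) (by simp)
    (by rw [inc_vert_node, if_pos ⟨rfl, Or.inl ⟨rfl, rfl⟩⟩])
    (by rw [inc_horiz_node, if_pos ⟨rfl, hg⟩])
    (by
      rintro (⟨g', c⟩ | ⟨i', k', j'⟩) h3 h4 h5
      · rw [inc_horiz_node, if_neg]
        rintro ⟨rfl, h⟩
        have := hcon g' (by rintro rfl; exact h4 rfl) h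
        omega
      · rw [inc_vert_node, if_neg]
        rintro ⟨rfl, ⟨h, h'⟩ | ⟨h, h'⟩⟩
        · exact h3 (vert_congr rfl (Fin.ext h'.symm) h)
        · simp at h')
  rw [h1, h2] at this
  exact absurd this (by decide)

end Layout

/-! ### Operations that preserve tour subgraphs -/

namespace Warehouse

open Layout

variable {m n : ℕ} {W : Warehouse m n}

/-- Deleting edges in pairs keeps all degrees even, so only connectivity has to be checked, edge by
edge of `S`. -/
theorem isTourSubgraph_of_le {S T : W.Edge → ℕ} (hS : W.IsTourSubgraph S) (hle : T ≤ S)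
    (hpar : ∀ e, (T e : ZMod 2) = S e) (hconn : ∀ e, 0 < S e → Conn T e.fst e.snd) :
    W.IsTourSubgraph T := by
  rw [isTourSubgraph_iff] at hS ⊢
  exact ⟨fun v => by rw [par_congr hpar, hS.1], fun v hv => (hS.2.1 v hv).of_edges hconn,
    fun e he => (hS.2.2 e (he.trans_le (hle e))).of_edges hconn⟩

theorem isTourSubgraph_add {T : W.Edge → ℕ} (hT : W.IsTourSubgraph T) {u : W.Vertex}
    (p : W.Route u u) (hu : Conn T W.depot u) : W.IsTourSubgraph (T + p.mult) := by
  have hmono : ∀ {v}, Conn T W.depot v → Conn (T + p.mult) W.depot v := fun h =>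
    h.mono fun e he => by rw [Pi.add_apply]; omega
  rw [isTourSubgraph_iff] at hT ⊢
  refine ⟨fun v => by rw [par_add, hT.1, p.par_closed, add_zero],
    fun v hv => hmono (hT.2.1 v hv), fun e he => ?_⟩
  by_cases h : 0 < T e
  · exact hmono (hT.2.2 e h)
  · have hp : 0 < p.mult e := by rw [Pi.add_apply] at he; omega
    refine (hmono hu).trans (p.conn_of_mem_support (fun f hf => ?_)
      (Route.mem_support_of_mem_edges (Route.mult_pos.1 hp)).1)
    have := Route.mult_pos.2 hf
    rw [Pi.add_apply]
    omega

/-- Removing a doubled edge to a dead end that need not be visited. -/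
theorem isTourSubgraph_trim {S T : W.Edge → ℕ} (hS : W.IsTourSubgraph S) {e : W.Edge}
    {u w : W.Vertex} (hj : e.Joins u w) (hu : ¬ W.Required u)
    (he : S e = 2) (hTe : T e = 0) (hT : ∀ f, f ≠ e → T f = S f)
    (hdead : ∀ f, f ≠ e → 0 < S f → f.fst ≠ u ∧ f.snd ≠ u) : W.IsTourSubgraph T := by
  classical
  rw [isTourSubgraph_iff] at hS ⊢
  have hdu : W.depot ≠ u := fun h => hu (Or.inl h.symm)
  have hpar : ∀ f, (T f : ZMod 2) = S f := fun f => by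
    by_cases h : f = e
    · rw [h, he, hTe]; rfl
    · rw [hT f h]
  -- Retract `u` to `w`: the deleted edge is contracted to a point and every other edge of `S`
  -- avoids `u`.
  have key : ∀ v, Conn S W.depot v → Conn T W.depot (if v = u then w else v) := by
    intro v hv
    induction hv with
    | refl => rw [if_neg hdu]; exact Conn.refl _ _
    | @tail x y _ hs ih =>
      obtain ⟨f, hf, hfj⟩ := hs
      by_cases hfe : f = e
      · subst hfe
        have hcases : (x = u ∧ y = w) ∨ (x = w ∧ y = u) := by
          rcases hj with ⟨rfl, rfl⟩ | ⟨rfl, rfl⟩ <;> rcases hfj with ⟨rfl, rfl⟩ | ⟨rfl, rfl⟩ <;>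
            simp
        rcases hcases with ⟨rfl, rfl⟩ | ⟨rfl, rfl⟩
        · rw [if_pos rfl] at ih
          split_ifs <;> exact ih
        · rw [if_pos rfl]
          split_ifs at ih <;> exact ih
      · have hne := hdead f hfe hf
        have hxy : x ≠ u ∧ y ≠ u := by
          rcases hfj with ⟨rfl, rfl⟩ | ⟨rfl, rfl⟩
          · exact hne
          · exact hne.symm
        rw [if_neg hxy.1] at ih
        rw [if_neg hxy.2]
        exact ih.trans (Conn.of_joins (by rwa [hT f hfe]) hfj)
  refine ⟨fun v => by rw [par_congr hpar, hS.1], fun v hv => ?_, fun f hf => ?_⟩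
  · have := key v (hS.2.1 v hv)
    rwa [if_neg (by rintro rfl; exact hu hv)] at this
  · have hfe : f ≠ e := by rintro rfl; omega
    rw [hT f hfe] at hf
    have := key _ (hS.2.2 f hf)
    rwa [if_neg (hdead f hfe hf).1] at this

/-- From a multiplicity of at least three, two copies can be dropped without changing parity or
connectivity. -/
theorem IsMinTourSubgraph.le_two {T : W.Edge → ℕ} (hT : W.IsMinTourSubgraph T) (e : W.Edge) :
    T e ≤ 2 := by
  classical
  by_contra! h
  have hle : Function.update T e (T e - 2) ≤ T := fun f => by
    by_cases hf : f = e
    · subst hf; simp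
    · simp [hf]
  refine (hT.2 _ (isTourSubgraph_of_le hT.1 hle (fun f => ?_) fun f hf =>
    Conn.of_joins ?_ f.joins_self)).not_gt (totalLength_lt hle (e := e) (by simp; omega))
  · by_cases hf : f = e
    · subst hf
      rw [Function.update_self, Nat.cast_sub (by omega)]
      exact sub_zero _
    · simp [hf]
  · by_cases hf' : f = e
    · subst hf'; simp; omega
    · simpa [hf'] using hf

/-! ### The shift between neighbouring aisles -/

/-- Move a doubled stretch of aisle `i` and a horizontal edge in row `x` to aisle `i'` and
row `y`. -/
def shift (T : W.Edge → ℕ) (g : Fin m) (i i' : Fin (m + 1)) (b x y : Fin (n + 2)) :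
    W.Edge → ℕ :=
  fun e => T e + col i' b e + single (.horiz g y) e - col i b e - single (.horiz g x) e

section shift

variable {T : W.Edge → ℕ} {g : Fin m} {i i' : Fin (m + 1)} {b x y : Fin (n + 2)}

/-- Under these hypotheses the truncated subtractions in `shift` are exact. -/
theorem shift_add (hcol : ∀ e, 0 < col i b e → 2 ≤ T e) (hx : 0 < T (.horiz g x)) :
    shift T g i i' b x y + col i b + single (.horiz g x) =
      T + col i' b + single (.horiz g y) := by
  funext e
  have h1 : col i b e + single (.horiz g x) e ≤ T e := by
    have hc := hcol e
    cases e with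
    | horiz g' c =>
      simp only [single, col]
      split_ifs with h
      · rw [← h]; omega
      · omega
    | vert i'' k j =>
      simp only [single, col, reduceCtorEq, if_false] at hc ⊢
      split_ifs at hc ⊢ <;> omega
  simp only [shift, Pi.add_apply]
  omega

theorem shift_horiz_x (hxy : x ≠ y) :
    shift T g i i' b x y (.horiz g x) = T (.horiz g x) - 1 := by
  simp [shift, single, col, hxy.symm]

theorem shift_horiz_y (hxy : x ≠ y) :
    shift T g i i' b x y (.horiz g y) = T (.horiz g y) + 1 := by
  simp [shift, single, col, hxy]

theorem shift_vert_left (hi : i ≠ i') {k : Fin (n + 1)} (hk : k.val < b.val) (j) :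
    shift T g i i' b x y (.vert i k j) = T (.vert i k j) - 1 := by
  simp [shift, single, col, hi, hk]

theorem shift_vert_other {a : Fin (m + 1)} {k : Fin (n + 1)}
    (h : (a ≠ i ∧ a ≠ i') ∨ b.val ≤ k.val) (j) :
    shift T g i i' b x y (.vert a k j) = T (.vert a k j) := by
  rcases h with h | h
  · simp [shift, single, col, h.1, h.2]
  · simp [shift, single, col, h.not_gt]

theorem totalLength_shift (hcol : ∀ e, 0 < col i b e → 2 ≤ T e) (hx : 0 < T (.horiz g x)) :
    W.totalLength (shift T g i i' b x y) = W.totalLength T := by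
  have := congrArg W.totalLength (shift_add (i' := i') (y := y) hcol hx)
  simp only [totalLength_add, totalLength_single, elen, totalLength_col i' i b] at this
  linarith

/-- The shift is `T` plus the closed rectangle, minus two copies of `col i b` and of the edge in row
`x`. Of the rectangle, at most that horizontal edge is lost, and the other three sides join its
ends. -/
theorem isTourSubgraph_shift (hT : W.IsTourSubgraph T) (hg : Separates g i i')
    (hcol : ∀ e, 0 < col i b e → 2 ≤ T e) (hx : 0 < T (.horiz g x))
    (hb : 0 < b) (hxy : (x = 0 ∧ y = b) ∨ (x = b ∧ y = 0)) :
    W.IsTourSubgraph (shift T g i i' b x y) := by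
  obtain ⟨p, hp⟩ := exists_route_rect (L := W.toLayout) hg b
  have hne : x ≠ y := by rcases hxy with ⟨rfl, rfl⟩ | ⟨rfl, rfl⟩ <;> [exact hb.ne; exact hb.ne']
  have hrect : (rect g i i' b : W.Edge → ℕ) =
      col i b + col i' b + single (.horiz g x) + single (.horiz g y) := by
    rcases hxy with ⟨rfl, rfl⟩ | ⟨rfl, rfl⟩ <;> rw [rect]
    abel
  have hadd := shift_add (i' := i') (y := y) hcol hx
  have hstart : Conn T W.depot (.node i 0) := by
    have : 2 ≤ T (.vert i 0 0) := hcol _ (by rw [col, if_pos ⟨rfl, hb⟩]; exact one_pos)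
    exact (isTourSubgraph_iff.1 hT).2.2 (.vert i 0 0) (by omega)
  have hS := isTourSubgraph_add hT p hstart
  rw [hp, hrect] at hS
  have hpt (e : W.Edge) := congrFun hadd e
  simp only [Pi.add_apply] at hpt
  refine isTourSubgraph_of_le hS (fun e => ?_) (fun e => ?_) fun e he => ?_
  · have := hpt e
    simp only [Pi.add_apply]
    omega
  · have h : T e + (col i b e + col i' b e + single (.horiz g x) e + single (.horiz g y) e) =
        shift T g i i' b x y e + 2 * (col i b e + single (.horiz g x) e) := by
      have := hpt e
      omega
    simp only [Pi.add_apply, h, Nat.cast_add, Nat.cast_mul]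
    rw [show ((2 : ℕ) : ZMod 2) = 0 from rfl, zero_mul, add_zero]
  · have hpos : ∀ e, 0 < T e ∨ 0 < rect g i i' b e → e ≠ .horiz g x →
        0 < shift T g i i' b x y e := by
      intro e he hex
      have h1 := hpt e
      have h2 := hcol e
      have h3 := col_le_one i b e
      have h4 : single (.horiz g x) e = 0 := by simp [single, Ne.symm hex]
      simp only [hrect, Pi.add_apply] at he
      omega
    by_cases hex : e = .horiz g x
    · subst hex
      refine p.conn_of_closed ?_ fun f hf hfe => hpos f (Or.inr (hp ▸ hf)) hfe
      rw [hp, hrect]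
      simp [single, col, hne.symm]
    · refine Conn.of_joins (hpos e ?_ hex) e.joins_self
      rw [hrect]
      simp only [Pi.add_apply] at he ⊢
      omega

end shift

/-! ### Extremal minimum tours -/

/-- The fully doubled subaisles of the outer blocks. -/
noncomputable def doubled (T : W.Edge → ℕ) : Finset (Fin (m + 1) × Fin (n + 1)) :=
  open Classical in
  Finset.univ.filter fun x => (x.2 = 0 ∨ x.2 = Fin.last n) ∧ ∀ j, T (.vert x.1 x.2 j) = 2

theorem mem_doubled {T : W.Edge → ℕ} {x} : x ∈ doubled T ↔
    (x.2 = 0 ∨ x.2 = Fin.last n) ∧ ∀ j, T (.vert x.1 x.2 j) = 2 := by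
  simp [doubled]

/-- Minimum tour subgraphs with as few doubled outer subaisles as possible. -/
def IsExtremal (W : Warehouse m n) (T : W.Edge → ℕ) : Prop :=
  W.IsMinTourSubgraph T ∧
    ∀ S, W.IsMinTourSubgraph S → (doubled T).card ≤ (doubled S).card

namespace IsExtremal

variable {T : W.Edge → ℕ} {g : Fin m} {i i' : Fin (m + 1)} {b x y : Fin (n + 2)}

theorem par_eq (h : W.IsExtremal T) (v : W.Vertex) : par T v = 0 :=
  (isTourSubgraph_iff.1 h.1.1).1 v

theorem not_shorter (h : W.IsExtremal T) {S : W.Edge → ℕ} (hS : W.IsTourSubgraph S) (hle : S ≤ T)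
    {e : W.Edge} (he : S e < T e) : False :=
  (h.1.2 S hS).not_gt (totalLength_lt hle he)

/-- The shift makes aisle `i` single above `b`, which destroys the doubled upper subaisle there. As
the count of doubled outer subaisles cannot drop, each one lost in `i` must be regained in `i'`. -/
theorem shift (h : W.IsExtremal T) (hg : Separates g i i')
    (hcol : ∀ e, 0 < col i b e → T e = 2) (hx : 0 < T (.horiz g x))
    (hb : 0 < b) (hxy : (x = 0 ∧ y = b) ∨ (x = b ∧ y = 0)) :
    W.IsExtremal (shift T g i i' b x y) ∧
      ∀ j, Warehouse.shift T g i i' b x y (.vert i' 0 j) = 2 := by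
  have hb' : (0 : Fin (n + 1)).val < b.val := hb
  have hcol' : ∀ e, 0 < col i b e → 2 ≤ T e := fun e he => (hcol e he).ge
  have hmin : W.IsMinTourSubgraph (Warehouse.shift T g i i' b x y) :=
    ⟨isTourSubgraph_shift h.1.1 hg hcol' hx hb hxy, fun S hS => by
      rw [totalLength_shift hcol' hx]; exact h.1.2 S hS⟩
  have hleft : ∀ k : Fin (n + 1), k.val < b.val →
      (i, k) ∉ doubled (Warehouse.shift T g i i' b x y) := by
    intro k hk hmem
    have h1 := (mem_doubled.1 hmem).2 0
    have h2 : T (.vert i k 0) = 2 := hcol _ (by simp [col, hk])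
    rw [shift_vert_left hg.ne hk, h2] at h1
    omega
  -- `f` moves the doubled subaisles of `i'` above `b` back to `i`. It is injective because none are
  -- left in `i` above `b`.
  set f : Fin (m + 1) × Fin (n + 1) → Fin (m + 1) × Fin (n + 1) :=
    fun z => if z.1 = i' ∧ z.2.val < b.val then (i, z.2) else z with hf
  have hmaps : ∀ z ∈ doubled (Warehouse.shift T g i i' b x y), f z ∈ doubled T := by
    rintro ⟨a, k⟩ hz
    by_cases hc : a = i' ∧ k.val < b.val
    · simp only [hf, if_pos hc]
      exact mem_doubled.2 ⟨(mem_doubled.1 hz).1, fun j => hcol _ (by simp [col, hc.2])⟩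
    · simp only [hf, if_neg hc]
      refine mem_doubled.2 ⟨(mem_doubled.1 hz).1, fun j => ?_⟩
      rw [← (mem_doubled.1 hz).2 j, shift_vert_other]
      by_cases hk : k.val < b.val
      · exact Or.inl ⟨by rintro rfl; exact hleft k hk hz, fun h => hc ⟨h, hk⟩⟩
      · exact Or.inr (not_lt.1 hk)
  have hinj : Set.InjOn f (doubled (Warehouse.shift T g i i' b x y)) := by
    rintro ⟨a, k⟩ hz ⟨a', k'⟩ hz' heq
    simp only [hf] at heq
    split_ifs at heq with h1 h2 h2
    · exact Prod.ext (h1.1.trans h2.1.symm) (Prod.ext_iff.1 heq).2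
    · rw [← heq] at hz'
      exact absurd hz' (hleft k h1.2)
    · rw [heq] at hz
      exact absurd hz (hleft k' h2.2)
    · exact heq
  have hcard := Finset.card_le_card_of_injOn f hmaps hinj
  refine ⟨⟨hmin, fun S hS => hcard.trans (h.2 S hS)⟩, ?_⟩
  have hi0 : (i, (0 : Fin (n + 1))) ∈ doubled T :=
    mem_doubled.2 ⟨Or.inl rfl, fun j => hcol _ (by rw [col, if_pos ⟨rfl, hb'⟩]; exact one_pos)⟩
  -- By extremality the injection `f` is onto, and the only possible preimage of `(i, 0)` is `(i',
  -- 0)`.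
  obtain ⟨⟨a, k⟩, hz, hzf⟩ := Finset.surj_on_of_inj_on_of_card_le (fun z _ => f z) hmaps
    (fun z z' hz hz' hzz => hinj hz hz' hzz) (h.2 _ hmin) _ hi0
  simp only [hf] at hzf
  split_ifs at hzf with h1
  · obtain rfl : a = i' := h1.1
    obtain rfl : 0 = k := (Prod.ext_iff.1 hzf).2
    exact (mem_doubled.1 hz).2
  · rw [← hzf] at hz
    exact absurd hz (hleft 0 hb')

theorem col_one (hX : ∀ j, T (.vert i 0 j) = 2) (e : W.Edge) (he : 0 < col i 1 e) :
    T e = 2 := by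
  cases e with
  | horiz => simp [col] at he
  | vert i' k j =>
    have h : i' = i ∧ k.val < (1 : Fin (n + 2)).val := by
      by_contra h
      simp only [col, if_neg h] at he
      omega
    obtain ⟨rfl, h⟩ := h
    obtain rfl : k = 0 := Fin.ext (by simpa using h)
    exact hX j

/-- With two copies, one would survive the shift down to cross-aisle `1`. All sides of the rectangle
would then be present, with the subaisle of `i'` doubled, so both copies of one of its segments
could be deleted. -/
theorem horiz_eq_one (h : W.IsExtremal T) (hX : ∀ j, T (.vert i 0 j) = 2)
    (hg : Separates g i i') (ht : 0 < T (.horiz g 0)) : T (.horiz g 0) = 1 := by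
  classical
  by_contra hne
  have hb : (0 : Fin (n + 2)) < 1 := Fin.zero_lt_one
  obtain ⟨h', hX'⟩ := h.shift hg (col_one hX) ht hb (Or.inl ⟨rfl, rfl⟩)
  set S := Warehouse.shift T g i i' 1 0 1 with hS
  have hle : Function.update S (.vert i' 0 0) 0 ≤ S := fun f => by
    by_cases hf : f = .vert i' 0 0
    · subst hf; simp
    · simp [hf]
  have hpos : ∀ f, 0 < S f → f ≠ .vert i' 0 0 → 0 < Function.update S (.vert i' 0 0) 0 f :=
    fun f hf hne => by simpa [hne] using hf
  refine h'.not_shorter (isTourSubgraph_of_le h'.1.1 hle (fun f => ?_) fun f hf => ?_) hle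
    (e := .vert i' 0 0) (by simp [hX'])
  · by_cases hf : f = .vert i' 0 0
    · subst hf; simp only [Function.update_self, hX']; rfl
    · simp [hf]
  · by_cases hfe : f = .vert i' 0 0
    · subst hfe
      obtain ⟨p, hp⟩ := exists_route_rect (L := W.toLayout) hg 1
      refine p.conn_of_closed ?_ fun f hf hfe => hpos f ?_ hfe
      · rw [hp]
        simp [rect, single, col, hg.ne.symm]
      · rw [hp] at hf
        have hadd := congrFun (shift_add (i' := i') (y := 1) (fun e he => (col_one hX e he).ge) ht) f
        have hc := col_one hX f
        have h3 := col_le_one i 1 f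
        simp only [rect, Pi.add_apply] at hf hadd
        rw [← hS] at hadd
        by_cases hf0 : f = .horiz g 0
        · subst hf0
          rw [hS, shift_horiz_x hb.ne]
          omega
        · have h4 : single (.horiz g 0) f = 0 := by simp [single, Ne.symm hf0]
          omega
    · exact Conn.of_joins (hpos f hf hfe) f.joins_self

/-- Otherwise the top intersection is a dead end that need not be visited, and trimming its doubled
segment shortens the tour. -/
theorem exists_horiz (h : W.IsExtremal T) (hX : ∀ j, T (.vert i 0 j) = 2)
    (hd : W.depot ≠ .node i 0) :
    ∃ g : Fin m, (g.castSucc = i ∨ g.succ = i) ∧ 0 < T (.horiz g 0) := by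
  classical
  by_contra! hcon
  have hle : Function.update T (.vert i 0 0) 0 ≤ T := fun f => by
    by_cases hf : f = .vert i 0 0
    · subst hf; simp
    · simp [hf]
  refine h.not_shorter (isTourSubgraph_trim (e := .vert i 0 0) (u := .node i 0) h.1.1
    (Edge.joins_self _) ?_ (hX 0) (by simp) (fun f hf => by simp [hf]) ?_) hle
    (e := .vert i 0 0) (by simp [hX])
  · rintro (h | ⟨_, _, _, h⟩)
    · exact hd h.symm
    · simp at h
  · rintro (⟨g, c⟩ | ⟨i', k, j⟩) hf hpos
    · constructor <;> intro h
      all_goals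
        simp only [Edge.fst, Edge.snd, Vertex.node.injEq] at h
        obtain ⟨h, rfl⟩ := h
        have := hcon g (by tauto)
        omega
    · constructor <;> intro h
      all_goals
        simp only [Edge.fst, Edge.snd, site_eq_node] at h
        obtain ⟨rfl, ⟨h, h'⟩ | ⟨h, h'⟩⟩ := h
      · exact hf (vert_congr rfl (Fin.ext h'.symm) h)
      · simp at h'
      · simp at h
      · simp at h'

/-- By parity the top of `i` has single edges on both sides. A shift across one of them removes it,
but the same argument at the new aisle would again require edges on both sides. -/
theorem no_horiz (h : W.IsExtremal T) (hX : ∀ j, T (.vert i 0 j) = 2)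
    (hg : g.castSucc = i ∨ g.succ = i) (ht : 0 < T (.horiz g 0)) : False := by
  obtain ⟨i₁, h₁⟩ := exists_separates hg
  obtain ⟨g₂, hne, hg₂, ht₂⟩ :=
    exists_other_horiz (h.par_eq _) hg (h.horiz_eq_one hX h₁ ht) (hX 0)
  obtain ⟨i₂, h₂⟩ := exists_separates hg₂
  have key : ∀ (g : Fin m) (i' : Fin (m + 1)), Separates g i i' → 0 < T (.horiz g 0) →
      W.depot ≠ .node i' 0 → False := by
    intro g i' hg ht hd
    have hb : (0 : Fin (n + 2)) < 1 := Fin.zero_lt_one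
    obtain ⟨h', hX'⟩ := h.shift hg (col_one hX) ht hb (Or.inl ⟨rfl, rfl⟩)
    have h0 := shift_horiz_x (T := T) (g := g) (i := i) (i' := i') (b := 1) hb.ne
    rw [h.horiz_eq_one hX hg ht] at h0
    obtain ⟨a, ha, hta⟩ := h'.exists_horiz hX' hd
    obtain ⟨i₃, h₃⟩ := exists_separates ha
    obtain ⟨a', hne', ha', hta'⟩ :=
      exists_other_horiz (h'.par_eq _) ha (h'.horiz_eq_one hX' h₃ hta) (hX' 0)
    have hag : a ≠ g := by rintro rfl; omega
    have hag' : a' ≠ g := by rintro rfl; omega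
    -- Three distinct gaps `g`, `a`, `a'` would border aisle `i'`, but an aisle borders at most two.
    have hgi := hg.right
    simp only [Fin.ext_iff, Fin.val_castSucc, Fin.val_succ, ne_eq] at *
    omega
  have h12 : i₁ ≠ i₂ := by
    simp only [Separates, Fin.ext_iff, Fin.val_castSucc, Fin.val_succ, ne_eq] at *
    omega
  -- The depot is at the top of at most one of the two neighbours; the shift goes to the other.
  by_cases hd : W.depot = .node i₁ 0
  · refine key g₂ i₂ h₂ ht₂ fun hd' => h12 ?_
    rw [hd] at hd'
    injection hd'
  · exact key g i₁ h₁ ht hd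

/-! ### Descending from a depot at the top -/

/-- All segments of aisle `i` above a vertex of that aisle are doubled. -/
def DoubledAbove (T : W.Edge → ℕ) (i : Fin (m + 1)) : W.Vertex → Prop
  | .node i' c => i' = i ∧ ∀ k : Fin (n + 1), k.val < c.val → ∀ j, T (.vert i k j) = 2
  | .pick i' k j => i' = i ∧ (∀ k' : Fin (n + 1), k'.val < k.val → ∀ j, T (.vert i k' j) = 2) ∧
      ∀ j', j'.val ≤ j.val → T (.vert i' k j') = 2

/-- A description uniform in `j`, so that a step along a segment needs no distinction between
intersections and pick locations. -/
theorem doubledAbove_site {k : Fin (n + 1)} (j : Fin (W.numPicks i' k + 2)) :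
    DoubledAbove T i (W.site i' k j) ↔ i' = i ∧
      (∀ k' : Fin (n + 1), k'.val < k.val → ∀ j, T (.vert i k' j) = 2) ∧
      ∀ j', j'.val < j.val → T (.vert i' k j') = 2 := by
  induction j using site_cases with
  | zero => simp [DoubledAbove]
  | last =>
    simp only [site_last, DoubledAbove, Fin.val_succ, Fin.val_last]
    constructor
    · rintro ⟨rfl, h⟩
      exact ⟨rfl, fun k' hk' => h k' (by omega), fun j' _ => h k (by omega) j'⟩
    · rintro ⟨rfl, h, h'⟩
      refine ⟨rfl, fun k' hk' j => ?_⟩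
      rcases Nat.lt_succ_iff_lt_or_eq.1 hk' with hk' | hk'
      · exact h k' hk' j
      · obtain rfl := Fin.ext hk'
        exact h' j j.isLt
  | pick j => simp [site_pick, DoubledAbove]

/-- A doubled stretch from the top of an aisle reaches a cross-aisle with a horizontal edge. -/
theorem exists_lower_horiz (h : W.IsExtremal T) (hX : ∀ j, T (.vert i 0 j) = 2)
    (hd : W.depot = .node i 0) (h0 : ∀ g : Fin m, g.castSucc = i ∨ g.succ = i → T (.horiz g 0) = 0)
    (hne : ∃ v, W.Required v ∧ W.aisleOf v ≠ i) :
    ∃ (g : Fin m) (b : Fin (n + 2)), (g.castSucc = i ∨ g.succ = i) ∧ 0 < T (.horiz g b) ∧ 0 < b ∧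
      ∀ e, 0 < col i b e → T e = 2 := by
  by_contra! hcon
  have hnone : ∀ b, DoubledAbove T i (.node i b) → ∀ g : Fin m, g.castSucc = i ∨ g.succ = i →
      T (.horiz g b) = 0 := by
    intro b hb g hg
    by_contra hT
    have hb0 : b ≠ 0 := by rintro rfl; exact hT (h0 g hg)
    obtain ⟨e, he, he'⟩ := hcon g b hg (Nat.pos_of_ne_zero hT) (Fin.pos_of_ne_zero hb0)
    cases e with
    | horiz => simp [col] at he
    | vert i' k j =>
      simp only [col] at he
      split_ifs at he with hk
      · obtain ⟨rfl, hk⟩ := hk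
        exact he' (hb.2 k hk j)
      · omega
  -- Doubling propagates downwards: the next segment used has even positive multiplicity, at most
  -- two by minimality.
  have htwo : ∀ {a c : ℕ}, a = 2 → Even (a + c) → 0 < c → c ≤ 2 → c = 2 := by
    rintro a c rfl ⟨r, hr⟩ h1 h2
    omega
  have hdown : ∀ (k : Fin (n + 1)) (j : Fin (W.numPicks i k + 1)), 0 < T (.vert i k j) →
      DoubledAbove T i (W.site i k j.castSucc) → T (.vert i k j) = 2 := by
    intro k j hpos hx
    induction j using Fin.cases with
    | zero =>
      by_cases hk : k = 0
      · subst hk; exact hX 0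
      · obtain ⟨k', rfl⟩ := Fin.exists_succ_eq.2 hk
        have h1 : T (.vert i k'.castSucc (Fin.last _)) = 2 :=
          hx.2 k'.castSucc (by simp) _
        exact htwo h1 (even_add_node (by simp) (h.par_eq _) (hnone _ hx)) hpos (h.1.le_two _)
    | succ j =>
      have h1 := ((doubledAbove_site _).1 hx).2.2 j.castSucc (by simp)
      exact htwo h1 (even_add_pick j (h.par_eq _)) hpos (h.1.le_two _)
  -- If the tour never branches off below a doubled stretch, everything reachable from the depot
  -- stays in aisle `i`.
  have hall : ∀ v, Conn T W.depot v → DoubledAbove T i v := by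
    intro v hv
    induction hv with
    | refl => rw [hd]; exact ⟨rfl, fun k hk => absurd hk (Nat.not_lt_zero _)⟩
    | @tail x y _ hs ih =>
      obtain ⟨e, he, hj⟩ := hs
      cases e with
      | horiz g c =>
        exfalso
        rcases hj with ⟨rfl, -⟩ | ⟨-, rfl⟩
        · obtain rfl : g.castSucc = i := ih.1
          exact he.ne' (hnone c ih g (Or.inl rfl))
        · obtain rfl : g.succ = i := ih.1
          exact he.ne' (hnone c ih g (Or.inr rfl))
      | vert i' k j =>
        rcases hj with ⟨rfl, rfl⟩ | ⟨rfl, rfl⟩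
        · obtain rfl : i' = i := ((doubledAbove_site _).1 ih).1
          have h2 := hdown k j he ih
          have ih := (doubledAbove_site _).1 ih
          refine (doubledAbove_site _).2 ⟨rfl, ih.2.1, fun j' hj' => ?_⟩
          rw [Fin.val_succ] at hj'
          rcases Nat.lt_succ_iff_lt_or_eq.1 hj' with hj' | hj'
          · exact ih.2.2 j' hj'
          · rw [Fin.ext hj']; exact h2
        · have ih := (doubledAbove_site _).1 ih
          exact (doubledAbove_site _).2 ⟨ih.1, ih.2.1, fun j' hj' => ih.2.2 j' (by
            rw [Fin.val_castSucc] at hj'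
            rw [Fin.val_succ]
            omega)⟩
  obtain ⟨v, hv, hvi⟩ := hne
  have := hall v ((isTourSubgraph_iff.1 h.1.1).2.1 v hv)
  cases v with
  | node => exact hvi this.1
  | pick => exact hvi this.1

/-- No subaisle of the upper block is doubled. -/
theorem not_doubled_zero (h : W.IsExtremal T)
    (hW : ∃ i i' : Fin (m + 1), i ≠ i' ∧ W.AisleNonempty i ∧ W.AisleNonempty i')
    (i : Fin (m + 1)) : ¬ ∀ j, T (.vert i 0 j) = 2 := by
  intro hX
  have h0 : ∀ g : Fin m, g.castSucc = i ∨ g.succ = i → T (.horiz g 0) = 0 := fun g hg =>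
    Nat.eq_zero_of_not_pos fun ht => h.no_horiz hX hg ht
  have hd : W.depot = .node i 0 := by
    by_contra hd
    obtain ⟨g, hg, ht⟩ := h.exists_horiz hX hd
    exact h.no_horiz hX hg ht
  have hne : ∃ v, W.Required v ∧ W.aisleOf v ≠ i := by
    obtain ⟨a, a', haa, ⟨v, hv, rfl⟩, v', hv', rfl⟩ := hW
    by_cases hvi : W.aisleOf v = i
    · exact ⟨v', hv', fun h => haa (hvi.trans h.symm)⟩
    · exact ⟨v, hv, hvi⟩
  obtain ⟨g, b, hg, ht, hb, hcol⟩ := h.exists_lower_horiz hX hd h0 hne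
  obtain ⟨i', hi⟩ := exists_separates hg
  -- Here the edge moves from row `b` up to row `0`, so the new doubled subaisle has a horizontal
  -- edge at its top.
  obtain ⟨h', hX'⟩ := h.shift hi hcol ht hb (Or.inr ⟨rfl, rfl⟩)
  refine h'.no_horiz hX' (hi.right) ?_
  rw [shift_horiz_y hb.ne']
  exact Nat.succ_pos _

end IsExtremal

end Warehouse

namespace Layout

variable {m n : ℕ} {L : Layout m n}

theorem conn_of_pos {T : L.Edge → ℕ} (hT : ∀ e, 0 < T e) (u v : L.Vertex) : Conn T u v := by
  have hcol (i : Fin (m + 1)) (c : Fin (n + 2)) : Conn T (.node i 0) (.node i c) := by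
    obtain ⟨p, -⟩ := L.exists_route_col i c
    exact p.conn fun e _ => hT e
  have hrow (i : Fin (m + 1)) : Conn T (.node 0 0) (.node i 0) := by
    induction i using Fin.induction with
    | zero => exact Conn.refl _ _
    | succ g ih => exact ih.trans (Conn.of_joins (hT (.horiz g 0)) (Or.inl ⟨rfl, rfl⟩))
  have key (v : L.Vertex) : Conn T (.node 0 0) v := by
    cases v with
    | node i c => exact (hrow i).trans (hcol i c)
    | pick i k j =>
      have hp := L.exists_route_segs i k j.castSucc.succ
      rw [site_pick] at hp
      obtain ⟨p, -⟩ := hp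
      exact ((hrow i).trans (hcol i _)).trans (p.conn fun e _ => hT e)
  exact (key u).symm.trans (key v)

/-! ### Reflection of a layout -/

/-- The layout turned upside down. -/
def flip (L : Layout m n) : Layout m n where
  spacing := L.spacing
  height k := L.height k.rev
  numPicks i k := L.numPicks i k.rev
  segLength i k j := L.segLength i k.rev j.rev
  spacing_pos := L.spacing_pos
  segLength_pos i k j := L.segLength_pos i k.rev j.rev
  sum_segLength i k := by
    rw [← L.sum_segLength i k.rev]
    exact Equiv.sum_comp Fin.revPerm (L.segLength i k.rev)

/-- The vertex of `L` at a vertex of the flipped layout. -/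
def flipVertex : L.flip.Vertex → L.Vertex
  | .node i c => .node i c.rev
  | .pick i k j => .pick i k.rev (Fin.rev (n := L.numPicks i k.rev) j)

/-- The edge of `L` at an edge of the flipped layout. -/
def flipEdge : L.flip.Edge → L.Edge
  | .horiz g c => .horiz g c.rev
  | .vert i k j => .vert i k.rev (Fin.rev (n := L.numPicks i k.rev + 1) j)

theorem flipVertex_bijective : Function.Bijective (flipVertex (L := L)) := by
  constructor
  · rintro (⟨i, c⟩ | ⟨i, k, j⟩) (⟨i', c'⟩ | ⟨i', k', j'⟩) h
    · simp only [flipVertex, Vertex.node.injEq, Fin.rev_inj] at h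
      rw [h.1, h.2]
    · simp [flipVertex] at h
    · simp [flipVertex] at h
    · simp only [flipVertex, Vertex.pick.injEq] at h
      obtain ⟨rfl, hk, hj⟩ := h
      obtain rfl := Fin.rev_injective hk
      rw [Fin.rev_injective (eq_of_heq hj)]
  · rintro (⟨i, c⟩ | ⟨i, k, j⟩)
    · exact ⟨.node i c.rev, by simp [flipVertex]⟩
    · obtain ⟨k, rfl⟩ := Fin.rev_surjective k
      exact ⟨.pick i k j.rev, congrArg (Vertex.pick i k.rev) (Fin.rev_rev j)⟩

theorem flipEdge_bijective : Function.Bijective (flipEdge (L := L)) := by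
  constructor
  · rintro (⟨i, c⟩ | ⟨i, k, j⟩) (⟨i', c'⟩ | ⟨i', k', j'⟩) h
    · simp only [flipEdge, Edge.horiz.injEq, Fin.rev_inj] at h
      rw [h.1, h.2]
    · simp [flipEdge] at h
    · simp [flipEdge] at h
    · simp only [flipEdge, Edge.vert.injEq] at h
      obtain ⟨rfl, hk, hj⟩ := h
      obtain rfl := Fin.rev_injective hk
      rw [Fin.rev_injective (eq_of_heq hj)]
  · rintro (⟨i, c⟩ | ⟨i, k, j⟩)
    · exact ⟨.horiz i c.rev, by simp [flipEdge]⟩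
    · obtain ⟨k, rfl⟩ := Fin.rev_surjective k
      exact ⟨.vert i k j.rev, congrArg (Edge.vert i k.rev) (Fin.rev_rev j)⟩

theorem flipVertex_site (i : Fin (m + 1)) (k : Fin (n + 1)) (j : Fin (L.numPicks i k.rev + 2)) :
    flipVertex (L.flip.site i k j) = L.site i k.rev j.rev := by
  induction j using site_cases (L := L.flip) (k := k) with
  | zero =>
    rw [site_zero, flipVertex, Fin.rev_castSucc]
    exact (congrArg (L.site i k.rev) (Fin.rev_zero _)).trans (site_last _ _) |>.symm
  | last =>
    rw [site_last, flipVertex, Fin.rev_succ]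
    exact (congrArg (L.site i k.rev) (Fin.rev_last _)).symm
  | pick j =>
    rw [site_pick, flipVertex, ← site_pick]
    have hrev {N : ℕ} (j : Fin N) : j.rev.castSucc.succ = j.castSucc.succ.rev := by
      simp only [Fin.ext_iff, Fin.val_succ, Fin.val_castSucc, Fin.val_rev]
      omega
    exact congrArg (L.site i k.rev) (hrev (N := L.numPicks i k.rev) j)

theorem flipEdge_joins {e : L.flip.Edge} {u v : L.flip.Vertex} (h : e.Joins u v) :
    (flipEdge e).Joins (flipVertex u) (flipVertex v) := by
  suffices h' : (flipEdge e).Joins (flipVertex e.fst) (flipVertex e.snd) by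
    rcases h with ⟨rfl, rfl⟩ | ⟨rfl, rfl⟩
    · exact h'
    · exact h'.symm
  cases e with
  | horiz g c => exact Or.inl ⟨rfl, rfl⟩
  | vert i k j =>
    -- Reflection exchanges the upper and lower ends of a vertical segment.
    refine Or.inr ⟨?_, ?_⟩
    · refine Eq.trans ?_ (flipVertex_site i k j.succ).symm
      exact congrArg (L.site i k.rev) (Fin.rev_succ j).symm
    · refine Eq.trans ?_ (flipVertex_site i k j.castSucc).symm
      exact congrArg (L.site i k.rev) (Fin.rev_castSucc j).symm

theorem inc_flip (e : L.flip.Edge) (v : L.flip.Vertex) :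
    inc (flipEdge e) (flipVertex v) = inc e v := by
  rw [inc_of_joins (flipEdge_joins e.joins_self)]
  simp only [flipVertex_bijective.1.eq_iff, inc]

theorem par_flip (T : L.Edge → ℕ) (v : L.flip.Vertex) :
    par (T ∘ flipEdge) v = par T (flipVertex v) := by
  rw [par, par, ← (flipEdge_bijective (L := L)).sum_comp]
  simp only [inc_flip, Function.comp_apply]

theorem totalLength_flip (T : L.Edge → ℕ) :
    L.flip.totalLength (T ∘ flipEdge) = L.totalLength T := by
  rw [totalLength_eq, totalLength_eq,
    ← (flipEdge_bijective (L := L)).sum_comp (fun e => (T e : ℝ) * elen e)]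
  refine Finset.sum_congr rfl fun e _ => ?_
  cases e <;> rfl

theorem conn_flip {T : L.Edge → ℕ} {u v : L.flip.Vertex} :
    Conn (T ∘ flipEdge) u v ↔ Conn T (flipVertex u) (flipVertex v) := by
  constructor
  · intro h
    induction h with
    | refl => exact Conn.refl _ _
    | tail _ hs ih =>
      obtain ⟨e, he, hj⟩ := hs
      exact ih.trans (Conn.of_joins he (flipEdge_joins hj))
  · intro h
    suffices key : ∀ w, Conn T (flipVertex u) w → ∀ v, flipVertex v = w →
        Conn (T ∘ flipEdge) u v from key _ h v rfl
    intro w h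
    induction h with
    | refl =>
      intro v hv
      rw [flipVertex_bijective.1 hv]
      exact Conn.refl _ _
    | @tail x y _ hs ih =>
      intro v hv
      obtain ⟨x, rfl⟩ := flipVertex_bijective.2 x
      obtain ⟨e, he, hj⟩ := hs
      obtain ⟨e, rfl⟩ := flipEdge_bijective.2 e
      refine (ih x rfl).trans (Conn.of_joins he ?_)
      have hj' := flipEdge_joins e.joins_self
      subst hv
      rcases hj with ⟨h1, h2⟩ | ⟨h1, h2⟩ <;> rcases hj' with ⟨h3, h4⟩ | ⟨h3, h4⟩
      all_goals
        first
        | exact Or.inl ⟨flipVertex_bijective.1 (by rw [← h1, ← h3]),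
            flipVertex_bijective.1 (by rw [← h2, ← h4])⟩
        | exact Or.inr ⟨flipVertex_bijective.1 (by rw [← h1, ← h3]),
            flipVertex_bijective.1 (by rw [← h2, ← h4])⟩
        | exact Or.inl ⟨flipVertex_bijective.1 (by rw [← h2, ← h4]),
            flipVertex_bijective.1 (by rw [← h1, ← h3])⟩
        | exact Or.inr ⟨flipVertex_bijective.1 (by rw [← h2, ← h4]),
            flipVertex_bijective.1 (by rw [← h1, ← h3])⟩

end Layout

/-! ### Existence of extremal tours and their reflection -/

namespace Warehouse

open Layout

variable {m n : ℕ} {W : Warehouse m n}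

/-- Only multiplicities up to two matter, which leaves a finite set. It is non-empty, since doubling
every edge gives a tour subgraph. -/
theorem exists_isMinTourSubgraph (W : Warehouse m n) : ∃ T, W.IsMinTourSubgraph T := by
  have hfin : {T : W.Edge → ℕ | W.IsTourSubgraph T ∧ T ≤ fun _ => 2}.Finite :=
    (Set.finite_Icc 0 fun _ => 2).subset fun T hT => ⟨fun _ => Nat.zero_le _, hT.2⟩
  have hne : {T : W.Edge → ℕ | W.IsTourSubgraph T ∧ T ≤ fun _ => 2}.Nonempty :=
    ⟨fun _ => 2, isTourSubgraph_iff.2 ⟨fun v => by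
      rw [par, show ((2 : ℕ) : ZMod 2) = 0 from rfl]; simp,
      fun v _ => conn_of_pos (fun _ => two_pos) _ _,
      fun e _ => conn_of_pos (fun _ => two_pos) _ _⟩, le_rfl⟩
  obtain ⟨T, hT, hmin⟩ := Set.exists_min_image _ W.totalLength hfin hne
  refine ⟨T, hT.1, fun S hS => ?_⟩
  -- Reduce each multiplicity to at most two, keeping its parity and whether it is positive.
  set R : W.Edge → ℕ := fun e => if S e = 0 then 0 else if Even (S e) then 2 else 1 with hR
  have hle : R ≤ S := fun e => by
    simp only [hR]
    split_ifs with h1 h2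
    · exact Nat.zero_le _
    · obtain ⟨r, hr⟩ := h2; omega
    · omega
  refine (hmin R ⟨isTourSubgraph_of_le hS hle (fun e => ?_) fun e he => ?_, fun e => ?_⟩).trans
    (totalLength_mono hle)
  · simp only [hR]
    split_ifs with h1 h2
    · rw [h1]
    · rw [(ZMod.natCast_eq_zero_iff_even).2 h2]; rfl
    · rw [(ZMod.natCast_eq_one_iff_odd).2 (Nat.not_even_iff_odd.1 h2)]; rfl
  · refine Conn.of_joins ?_ e.joins_self
    simp only [hR, he.ne', if_false]
    split_ifs <;> simp
  · simp only [hR]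
    split_ifs <;> simp

theorem exists_isExtremal (W : Warehouse m n) : ∃ T, W.IsExtremal T := by
  obtain ⟨T₀, h₀⟩ := W.exists_isMinTourSubgraph
  obtain ⟨T, hT, hmin⟩ := exists_minimalFor_of_wellFoundedLT W.IsMinTourSubgraph
    (fun T => (doubled T).card) ⟨T₀, h₀⟩
  exact ⟨T, hT, fun S hS => (le_total _ _).elim id (hmin hS)⟩

/-- The warehouse turned upside down. -/
noncomputable abbrev flip (W : Warehouse m n) : Warehouse m n where
  toLayout := W.toLayout.flip
  depot := Function.surjInv flipVertex_bijective.2 W.depot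

theorem flipVertex_depot : flipVertex W.flip.depot = W.depot :=
  Function.surjInv_eq flipVertex_bijective.2 W.depot

theorem required_flip {v : W.flip.Vertex} : W.flip.Required v ↔ W.Required (flipVertex v) := by
  refine or_congr ?_ ?_
  · rw [← flipVertex_depot (W := W)]
    exact (flipVertex_bijective (L := W.toLayout)).1.eq_iff.symm
  · cases v with
    | node i c => exact iff_of_false (fun ⟨_, _, _, h⟩ => nomatch h) fun ⟨_, _, _, h⟩ => nomatch h
    | pick i k j => exact ⟨fun _ => ⟨_, _, _, rfl⟩, fun _ => ⟨_, _, _, rfl⟩⟩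

theorem aisleOf_flipVertex (v : W.flip.Vertex) : W.aisleOf (flipVertex v) = W.flip.aisleOf v := by
  cases v <;> rfl

theorem aisleNonempty_flip {i : Fin (m + 1)} (h : W.AisleNonempty i) : W.flip.AisleNonempty i := by
  obtain ⟨v, hv, rfl⟩ := h
  obtain ⟨v, rfl⟩ := flipVertex_bijective.2 v
  exact ⟨v, required_flip.2 hv, (aisleOf_flipVertex v).symm⟩

theorem isTourSubgraph_flip {T : W.Edge → ℕ} :
    W.flip.IsTourSubgraph (T ∘ flipEdge) ↔ W.IsTourSubgraph T := by
  rw [isTourSubgraph_iff, isTourSubgraph_iff]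
  refine and_congr ?_ (and_congr ?_ ?_)
  · rw [(flipVertex_bijective (L := W.toLayout)).2.forall]
    exact forall_congr' fun v => by rw [← par_flip]
  · rw [(flipVertex_bijective (L := W.toLayout)).2.forall]
    refine forall_congr' fun v => imp_congr required_flip ?_
    rw [← flipVertex_depot (W := W)]
    exact conn_flip
  · rw [(flipEdge_bijective (L := W.toLayout)).2.forall]
    refine forall_congr' fun e => imp_congr_right fun (he : 0 < T (flipEdge e)) => ?_
    have h1 : Conn T (flipEdge e).fst (flipVertex e.fst) := by
      rcases flipEdge_joins e.joins_self with ⟨h, -⟩ | ⟨-, h⟩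
      · rw [h]; exact Conn.refl _ _
      · rw [← h]; exact Conn.of_joins he (flipEdge e).joins_self
    rw [← flipVertex_depot (W := W)]
    exact conn_flip.trans ⟨fun h => h.trans h1.symm, fun h => h.trans h1⟩

theorem exists_comp_flipEdge (S : W.flip.Edge → ℕ) : ∃ T : W.Edge → ℕ, T ∘ flipEdge = S :=
  ⟨S ∘ Function.surjInv (flipEdge_bijective (L := W.toLayout)).2, funext fun e =>
    congrArg S (Function.leftInverse_surjInv (flipEdge_bijective (L := W.toLayout)) e)⟩

theorem isMinTourSubgraph_flip {T : W.Edge → ℕ} :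
    W.flip.IsMinTourSubgraph (T ∘ flipEdge) ↔ W.IsMinTourSubgraph T := by
  refine and_congr isTourSubgraph_flip ⟨fun h S hS => ?_, fun h S hS => ?_⟩
  · have := h _ (isTourSubgraph_flip.2 hS)
    rwa [totalLength_flip, totalLength_flip] at this
  · obtain ⟨S, rfl⟩ := exists_comp_flipEdge S
    rw [totalLength_flip, totalLength_flip]
    exact h S (isTourSubgraph_flip.1 hS)

/-- Reflection exchanges the two outer blocks. Since `doubled` counts both, extremality is
invariant, and a single `T` serves for both blocks. -/
theorem card_doubled_flip (T : W.Edge → ℕ) :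
    (doubled (W := W.flip) (T ∘ flipEdge)).card = (doubled T).card := by
  refine Finset.card_equiv ((Equiv.refl _).prodCongr Fin.revPerm) fun ⟨i, k⟩ => ?_
  rw [mem_doubled, mem_doubled]
  refine and_congr ?_ ⟨fun h j => ?_, fun h j => h _⟩
  · simp only [Equiv.prodCongr_apply, Prod.map_snd, Fin.revPerm_apply, Fin.rev_eq_iff,
      Fin.rev_zero, Fin.rev_last, or_comm]
  · exact (congrArg (fun j => T (.vert i k.rev j)) (Fin.rev_rev j)).symm.trans (h (Fin.rev j))

theorem IsExtremal.flip {T : W.Edge → ℕ} (h : W.IsExtremal T) :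
    W.flip.IsExtremal (T ∘ flipEdge) := by
  refine ⟨isMinTourSubgraph_flip.2 h.1, fun S hS => ?_⟩
  obtain ⟨S, rfl⟩ := exists_comp_flipEdge S
  rw [card_doubled_flip, card_doubled_flip]
  exact h.2 S (isMinTourSubgraph_flip.1 hS)

theorem IsExtremal.not_doubled_last {T : W.Edge → ℕ} (h : W.IsExtremal T)
    (hW : ∃ i i' : Fin (m + 1), i ≠ i' ∧ W.AisleNonempty i ∧ W.AisleNonempty i')
    (i : Fin (m + 1)) : ¬ ∀ j, T (.vert i (Fin.last n) j) = 2 := by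
  intro hX
  obtain ⟨a, a', haa, ha, ha'⟩ := hW
  refine h.flip.not_doubled_zero ⟨a, a', haa, aisleNonempty_flip ha, aisleNonempty_flip ha'⟩ i
    fun j => ?_
  -- The block is generalised because the type of `j` depends on it.
  have hX' : ∀ k, k = Fin.last n → ∀ j, T (.vert i k j) = 2 := by rintro _ rfl; exact hX
  exact hX' _ (Fin.rev_zero n) _

end Warehouse

theorem mainTheorem1 {m n : ℕ} (W : Warehouse m n)
    (hW : ∃ i i' : Fin (m + 1), i ≠ i' ∧ W.AisleNonempty i ∧ W.AisleNonempty i') :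
    ∃ T : W.Edge → ℕ, W.IsMinTourSubgraph T ∧
      ∀ (i : Fin (m + 1)) (a b : Fin (n + 2)),
        W.IsDoubleEdge T i a b → ¬ Layout.IncludesOuter a b := by
  obtain ⟨T, hT⟩ := W.exists_isExtremal
  refine ⟨T, hT.1, fun i a b ⟨hab, hD, _⟩ hout => ?_⟩
  rw [Fin.lt_def] at hab
  rcases hout with rfl | rfl
  · exact hT.not_doubled_zero hW i (hD 0 (Fin.zero_le _) (Nat.succ_le_of_lt hab))
  · exact hT.not_doubled_last hW i (hD (Fin.last n) (Nat.lt_succ_iff.1 hab) le_rfl)
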